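/- Let $K$ be a field, let $n\ge 1$, and let $Q$ be the oriented cycle with vertex set $\mathbb Z/n$ and exactly one arrow $i\to i+1$ for each $i$. Let $A\cong KQ/I$ be a cyclic Nakayama algebra with $n$ simple modules, i.e. $I$ is an admissible ideal of the path algebra $KQ$. Its Kupisch series is the list $[c_0,c_1,\dots,c_{n-1}]$, $c_i=\dim_K e_iA$ (where $e_i$ is the trivial path at $i$, and paths are composed from left to right); it is considered up to cyclic shift. Suppose that $A$ is quasi-hereditary, i.e. there is a chain $0=I_0\subset I_1\subset\dots\subset I_m=A$ of two-sided ideals such that each $H=I_{k+1}/I_k$ is a heredity ideal of $B=A/I_k$, meaning that $H^2=H$, $H\,\mathrm{rad}(B)\,H=0$ and $H$ is projective as a right $B$-module. Then $$\operatorname{gldim}(A)=n\iff \text{the Kupisch series of }A\text{ is, up to cyclic shift, }[\underbrace{2,2,\dots,2}_{n-1},3].$$ If the Kupisch series of $A$ is not of this form, then $\operatorname{gldim}(A)\le n-1$. Here $\operatorname{gldim}(A)$ is the supremum of the projective dimensions of the finitely generated right $A$-modules. -/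

import Mathlib

universe u v w

/-- The path algebra `K Q` of a quiver `Q` with vertex set `V`: the `K`-vector space whose basis is
the set of all paths `⟨i, j, p⟩` (where `p` is a path from `i` to `j`, including the trivial paths). -/
def PathAlgebra (K : Type u) (V : Type v) [Quiver.{w} V] [Field K] : Type _ :=
  (Σ i j : V, Quiver.Path i j) →₀ K

namespace PathAlgebra

variable {K : Type u} {V : Type v} [Quiver.{w} V]

noncomputable instance [Field K] : AddCommGroup (PathAlgebra K V) :=
  inferInstanceAs (AddCommGroup ((Σ i j : V, Quiver.Path i j) →₀ K))

noncomputable instance [Field K] : Module K (PathAlgebra K V) :=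
  inferInstanceAs (Module K ((Σ i j : V, Quiver.Path i j) →₀ K))

/-- The basis element of the path algebra given by a path. -/
noncomputable def ofPath (K : Type u) [Field K] {i j : V} (p : Quiver.Path i j) :
    PathAlgebra K V :=
  Finsupp.single (⟨i, j, p⟩ : Σ i j : V, Quiver.Path i j) (1 : K)

/-- The trivial path `e_i` at the vertex `i`. -/
noncomputable def idem (K : Type u) [Field K] (i : V) : PathAlgebra K V :=
  ofPath K (Quiver.Path.nil : Quiver.Path i i)

open Classical in
/-- The product of two paths in the path algebra: the concatenation "first `p`, then `q`" if `q`
starts where `p` ends, and zero otherwise. -/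
noncomputable def pathMul (K : Type u) [Field K] (p q : Σ i j : V, Quiver.Path i j) :
    PathAlgebra K V :=
  if h : p.2.1 = q.1 then ofPath K (p.2.2.comp (q.2.2.cast h.symm rfl)) else 0

theorem pathMul_comp (K : Type u) [Field K] {i j k : V} (p : Quiver.Path i j)
    (q : Quiver.Path j k) :
    pathMul K ⟨i, j, p⟩ ⟨j, k, q⟩ = ofPath K (p.comp q) := by
  simp [pathMul]

theorem pathMul_of_ne (K : Type u) [Field K] {i j k l : V} (p : Quiver.Path i j)
    (q : Quiver.Path k l) (h : j ≠ k) :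
    pathMul K ⟨i, j, p⟩ ⟨k, l, q⟩ = 0 := by
  simp [pathMul, h]

variable [Field K]

/-- The bilinear extension of the product of paths. -/
noncomputable def mulHom (K : Type u) (V : Type v) [Quiver.{w} V] [Field K] :
    PathAlgebra K V →ₗ[K] PathAlgebra K V →ₗ[K] PathAlgebra K V :=
  Finsupp.linearCombination K fun p : Σ i j : V, Quiver.Path i j =>
    (Finsupp.linearCombination K fun q : Σ i j : V, Quiver.Path i j => pathMul K p q :
      ((Σ i j : V, Quiver.Path i j) →₀ K) →ₗ[K] PathAlgebra K V)

theorem mulHom_ofPath {i j k l : V} (p : Quiver.Path i j) (q : Quiver.Path k l) :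
    mulHom K V (ofPath K p) (ofPath K q) = pathMul K ⟨i, j, p⟩ ⟨k, l, q⟩ := by
  have h₁ := Finsupp.linearCombination_single K (1 : K) (⟨i, j, p⟩ : Σ i j : V, Quiver.Path i j)
    (v := fun p : Σ i j : V, Quiver.Path i j =>
      (Finsupp.linearCombination K fun q : Σ i j : V, Quiver.Path i j => pathMul K p q :
        ((Σ i j : V, Quiver.Path i j) →₀ K) →ₗ[K] PathAlgebra K V))
  have h₂ := Finsupp.linearCombination_single K (1 : K) (⟨k, l, q⟩ : Σ i j : V, Quiver.Path i j)
    (v := fun q => pathMul K ⟨i, j, p⟩ q)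
  rw [one_smul] at h₁ h₂
  exact (congrArg (fun f => f (ofPath K q)) h₁).trans h₂

theorem hom_ext {M : Type*} [AddCommMonoid M] [Module K M] {f g : PathAlgebra K V →ₗ[K] M}
    (h : ∀ (i j : V) (p : Quiver.Path i j), f (ofPath K p) = g (ofPath K p)) : f = g := by
  refine Finsupp.lhom_ext' fun p => LinearMap.ext_ring ?_
  exact h p.1 p.2.1 p.2.2

noncomputable instance : Mul (PathAlgebra K V) := ⟨fun x y => mulHom K V x y⟩

theorem mul_def (x y : PathAlgebra K V) : x * y = mulHom K V x y := rfl

theorem ofPath_mul_ofPath {i j k : V} (p : Quiver.Path i j) (q : Quiver.Path j k) :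
    ofPath K p * ofPath K q = ofPath K (p.comp q) := by
  rw [mul_def, mulHom_ofPath, pathMul_comp]

theorem ofPath_mul_ofPath_of_ne {i j k l : V} (p : Quiver.Path i j) (q : Quiver.Path k l)
    (h : j ≠ k) : ofPath K p * ofPath K q = 0 := by
  rw [mul_def, mulHom_ofPath, pathMul_of_ne _ _ _ h]

theorem ofPath_mul_assoc {i j k l m n : V} (p : Quiver.Path i j) (q : Quiver.Path k l)
    (r : Quiver.Path m n) :
    ofPath K p * ofPath K q * ofPath K r = ofPath K p * (ofPath K q * ofPath K r) := by
  by_cases h : j = k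
  · subst h
    by_cases h' : l = m
    · subst h'
      simp only [ofPath_mul_ofPath, Quiver.Path.comp_assoc]
    · rw [ofPath_mul_ofPath, ofPath_mul_ofPath_of_ne _ _ h', ofPath_mul_ofPath_of_ne _ _ h']
      simp [mul_def]
  · rw [ofPath_mul_ofPath_of_ne _ _ h]
    by_cases h' : l = m
    · subst h'
      rw [ofPath_mul_ofPath, ofPath_mul_ofPath_of_ne _ _ h]
      simp [mul_def]
    · rw [ofPath_mul_ofPath_of_ne _ _ h']
      simp [mul_def]

theorem add_mul' (x y z : PathAlgebra K V) : (x + y) * z = x * z + y * z := by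
  simp only [mul_def, map_add, LinearMap.add_apply]

theorem mul_add' (x y z : PathAlgebra K V) : x * (y + z) = x * y + x * z := by
  simp only [mul_def, map_add]

theorem smul_mul' (r : K) (x y : PathAlgebra K V) : (r • x) * y = r • (x * y) := by
  simp only [mul_def, map_smul, LinearMap.smul_apply]

theorem mul_smul' (r : K) (x y : PathAlgebra K V) : x * (r • y) = r • (x * y) := by
  simp only [mul_def, map_smul]

theorem mul_assoc' (x y z : PathAlgebra K V) : x * y * z = x * (y * z) := by
  let F : PathAlgebra K V →ₗ[K] PathAlgebra K V →ₗ[K] PathAlgebra K V →ₗ[K] PathAlgebra K V :=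
    (LinearMap.llcomp K (PathAlgebra K V) (PathAlgebra K V) _ (mulHom K V)) ∘ₗ mulHom K V
  let G : PathAlgebra K V →ₗ[K] PathAlgebra K V →ₗ[K] PathAlgebra K V →ₗ[K] PathAlgebra K V :=
    LinearMap.lcomp K _ (mulHom K V) ∘ₗ
      (LinearMap.llcomp K (PathAlgebra K V) (PathAlgebra K V) (PathAlgebra K V)) ∘ₗ mulHom K V
  have h : F = G :=
    hom_ext fun i j p => hom_ext fun k l q => hom_ext fun m n r => ofPath_mul_assoc p q r
  exact congrArg (fun H => H x y z) h

variable [Fintype V]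

noncomputable instance : One (PathAlgebra K V) := ⟨∑ i : V, idem K i⟩

theorem one_def : (1 : PathAlgebra K V) = ∑ i : V, idem K i := rfl

theorem one_mul' (x : PathAlgebra K V) : 1 * x = x := by
  have h : mulHom K V 1 = LinearMap.id := by
    refine hom_ext fun i j p => ?_
    rw [one_def, map_sum, LinearMap.sum_apply, Finset.sum_eq_single i]
    · exact (ofPath_mul_ofPath Quiver.Path.nil p).trans (by rw [Quiver.Path.nil_comp]; rfl)
    · intro k _ hk
      exact ofPath_mul_ofPath_of_ne _ _ hk
    · simp
  exact congrArg (fun H => H x) h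

theorem mul_one' (x : PathAlgebra K V) : x * 1 = x := by
  have h : (mulHom K V).flip 1 = LinearMap.id := by
    refine hom_ext fun i j p => ?_
    rw [LinearMap.flip_apply, one_def, map_sum, Finset.sum_eq_single j]
    · exact ofPath_mul_ofPath p Quiver.Path.nil
    · intro k _ hk
      exact ofPath_mul_ofPath_of_ne _ _ hk.symm
    · simp
  exact congrArg (fun H => H x) h

noncomputable instance : Ring (PathAlgebra K V) :=
  { (inferInstance : AddCommGroup (PathAlgebra K V)) with
    mul := fun x y => x * y
    one := 1
    left_distrib := mul_add'
    right_distrib := add_mul'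
    zero_mul := fun x => by
      change mulHom K V 0 x = 0
      simp only [map_zero, LinearMap.zero_apply]
    mul_zero := fun x => by
      change mulHom K V x 0 = 0
      simp only [map_zero]
    mul_assoc := mul_assoc'
    one_mul := one_mul'
    mul_one := mul_one' }

noncomputable instance : Algebra K (PathAlgebra K V) :=
  Algebra.ofModule smul_mul' mul_smul'

/-- The `m`-th power of the arrow ideal, i.e. the span of all paths of length at least `m`. -/
noncomputable def arrowIdealPow (K : Type u) (V : Type v) [Quiver.{w} V] [Field K] (m : ℕ) :
    Submodule K (PathAlgebra K V) :=
  Submodule.span K {x | ∃ (i j : V) (p : Quiver.Path i j), m ≤ p.length ∧ x = ofPath K p}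

end PathAlgebra

/-- `φ : K Q → A` presents `A` as a bound quiver algebra: `φ` is surjective and its kernel is an
admissible ideal, so that `A ≅ K Q / I` with `I` admissible. -/
structure IsBoundQuiverPresentation {K : Type*} {V : Type*} [Quiver V] [Fintype V] [Field K]
    {A : Type*} [Ring A] [Algebra K A] (φ : PathAlgebra K V →ₐ[K] A) : Prop where
  surjective : Function.Surjective φ
  exists_arrowIdealPow_le :
    ∃ N : ℕ, 2 ≤ N ∧ PathAlgebra.arrowIdealPow K V N ≤ LinearMap.ker φ.toLinearMap
  le_arrowIdealPow_two : LinearMap.ker φ.toLinearMap ≤ PathAlgebra.arrowIdealPow K V 2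

/-- The vertices `0, …, n - 1` of the oriented cycle, regarded as integers modulo `n`. -/
def CyclicQuiver (n : ℕ) : Type := ZMod n

/-- There is exactly one arrow `i → i + 1` for every vertex `i` and there are no other arrows. -/
instance (n : ℕ) : Quiver (CyclicQuiver n) where
  Hom (i j : ZMod n) := PLift (j = i + 1)

instance (n : ℕ) [NeZero n] : Fintype (CyclicQuiver n) := inferInstanceAs (Fintype (ZMod n))

/-- The Kupisch series `[c_0, …, c_{n-1}]` of a Nakayama algebra `A` presented by the oriented cycle
with `n` vertices: `c_i` is the `K`-dimension of the projective right module `e_i A`. -/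
noncomputable def kupischSeries {K : Type*} [Field K] {n : ℕ} [NeZero n] {A : Type*} [Ring A]
    [Algebra K A] (φ : PathAlgebra K (CyclicQuiver n) →ₐ[K] A) : List ℕ :=
  List.ofFn fun i : Fin n =>
    Module.finrank K (LinearMap.range
      (LinearMap.mulLeft K (φ (PathAlgebra.idem K (((i : ℕ) : ZMod n) : CyclicQuiver n)))))

/-- The global dimension of a ring `A` : the supremum of the projective dimensions of the finitely
generated right `A`-modules (right `A`-modules are modules over the opposite ring). -/
noncomputable def globalDimension (A : Type u) [Ring A] : WithBot ℕ∞ :=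
  ⨆ (M : ModuleCat.{u} Aᵐᵒᵖ) (_ : Module.Finite Aᵐᵒᵖ M), CategoryTheory.projectiveDimension M

/-- A two-sided ideal `I` of `A` is a heredity ideal if `I² = I`, `I J I = 0` for the Jacobson radical
`J` of `A`, and `I` is projective as a right `A`-module. -/
structure IsHeredityIdeal {A : Type*} [Ring A] (I : TwoSidedIdeal A) : Prop where
  idempotent : I.asIdeal * I.asIdeal = I.asIdeal
  mul_jacobson_mul : ∀ x ∈ I, ∀ j ∈ Ring.jacobson A, ∀ y ∈ I, x * j * y = 0
  projective : Module.Projective Aᵐᵒᵖ I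

/-- A ring `A` is quasi-hereditary if it has a heredity chain, i.e. a chain
`0 = I_0 < I_1 < ⋯ < I_m = A` of two-sided ideals such that `I_{k+1} / I_k` is a heredity ideal
of `A / I_k` for all `k < m`. -/
def IsQuasiHereditary (A : Type*) [Ring A] : Prop :=
  ∃ (m : ℕ) (I : Fin (m + 1) → TwoSidedIdeal A), StrictMono I ∧ I 0 = ⊥ ∧ I (Fin.last m) = ⊤ ∧
    ∀ k : Fin m, IsHeredityIdeal ((I k.succ).map (I k.castSucc).ringCon.mk')

/-! Write `c_j` for the length of `e_j A` and let `X` be the sum of all arrows. Every element of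
`e_j A` is `e_j X^r` times a unit that is a polynomial in `X` (`exists_unit`), so the modules `e_j
X^l A` can be handled by exponents alone: such a module is covered by `e_{j+l} A`, and the kernel is
again of this type.

Quasi-heredity enters only through the bottom ideal `H` of the chain. It contains some `e_i`, and `H
J H = 0` gives `c_i ≤ n`. Projectivity of `H` and `H² = H` then force, for `f(p) = p + c_{i+p}` and
`1 ≤ p ≤ n`, that `f(p) ≤ n` or `f(p) = f(n) = n + c_i` (`exists_of_isHeredityIdeal`).

For `a ≤ b` think of `e_{i+a} X^{b-a} A` as the interval `[b, f(a))`; its syzygy is `[f(a), f(b))`.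
So a syzygy replaces the pair `(a, b)` by `(b, f(a))`. Either `f(a) ≤ n` and the pair has moved
towards `n`, or `f(a) = f(b)` and the resolution stops. Hence the projective dimension is at most `n
- b` (`projDimLT_interval`). Applied to the radicals `e_j X A`, the syzygies of the simple modules,
this gives global dimension at most `n`. The value `n` can only come from `j = i` with `c_i = 2`,
and a jump `c_{i+s} ≥ 3` with `1 ≤ s ≤ n - 2` saves a step (`projDimLT_interval_of_three_le`). What
remains is the series `[2, …, 2, 3]`, for which the resolution really has length `n`
(`not_projDimLT_radical`). -/

/-- Orthogonal idempotents `e i` indexed by `ZMod n` with sum `1` and a nilpotent element `X` with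
`e i * X = X * e (i + 1) ≠ 0` such that the elements `e i * X ^ l` span `A`. -/
structure CyclicFrame (K : Type*) [Field K] {n : ℕ} [NeZero n] {A : Type*} [Ring A] [Algebra K A]
    (e : ZMod n → A) (X : A) : Prop where
  mul_self : ∀ i, e i * e i = e i
  mul_of_ne : ∀ i j, i ≠ j → e i * e j = 0
  sum_eq_one : ∑ i, e i = 1
  mul_X : ∀ i, e i * X = X * e (i + 1)
  nilpotent : IsNilpotent X
  mem_span : ∀ a : A, a ∈ Submodule.span K (Set.range fun p : ZMod n × ℕ => e p.1 * X ^ p.2)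
  mul_X_ne_zero : ∀ i, e i * X ≠ 0

/-- The least `l` with `e i * X ^ l = 0`. -/
noncomputable def frameLength {n : ℕ} {A : Type*} [Ring A] (e : ZMod n → A) (X : A) (i : ZMod n) :
    ℕ :=
  sInf {l : ℕ | e i * X ^ l = 0}

/-! ### Multiplication in a cyclic frame; the modules `e i A` are uniserial -/

namespace CyclicFrame

variable {K : Type*} [Field K] {n : ℕ} [NeZero n] {A : Type*} [Ring A] [Algebra K A]
  {e : ZMod n → A} {X : A}

theorem mul_pow (h : CyclicFrame K e X) (i : ZMod n) (l : ℕ) :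
    e i * X ^ l = X ^ l * e (i + l) := by
  induction l with
  | zero => simp
  | succ l ih =>
    rw [pow_succ, ← mul_assoc, ih, mul_assoc, h.mul_X, mul_assoc, Nat.cast_succ, add_assoc]

theorem mul_pow_mul (h : CyclicFrame K e X) (i : ZMod n) (l : ℕ) :
    e i * X ^ l * e (i + l) = e i * X ^ l := by
  rw [h.mul_pow, mul_assoc, h.mul_self]

theorem mul_mul_pow (h : CyclicFrame K e X) (i : ZMod n) (l : ℕ) :
    e i * (e i * X ^ l) = e i * X ^ l := by
  rw [← mul_assoc, h.mul_self]

theorem exists_aeval (h : CyclicFrame K e X) (i : ZMod n) (y : A) :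
    ∃ p : Polynomial K, e i * y = e i * Polynomial.aeval X p := by
  induction h.mem_span y using Submodule.span_induction with
  | mem x hx =>
    obtain ⟨⟨j, l⟩, rfl⟩ := hx
    by_cases hij : i = j
    · subst hij
      exact ⟨Polynomial.X ^ l, by simp [← mul_assoc, h.mul_self]⟩
    · exact ⟨0, by simp [← mul_assoc, h.mul_of_ne _ _ hij]⟩
  | zero => exact ⟨0, by simp⟩
  | add x y _ _ hx hy =>
    obtain ⟨p, hp⟩ := hx
    obtain ⟨q, hq⟩ := hy
    exact ⟨p + q, by rw [mul_add, hp, hq, map_add, mul_add]⟩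
  | smul a x _ hx =>
    obtain ⟨p, hp⟩ := hx
    exact ⟨a • p, by rw [mul_smul_comm, hp, map_smul, mul_smul_comm]⟩

theorem exists_eq_X_pow_mul {p : Polynomial K} (h0 : p ≠ 0) :
    ∃ (r : ℕ) (q : Polynomial K), p = Polynomial.X ^ r * q ∧ ¬ Polynomial.X ∣ q := by
  obtain ⟨q, hq, hd⟩ := Polynomial.exists_eq_pow_rootMultiplicity_mul_and_not_dvd p h0 0
  rw [map_zero, sub_zero] at hq hd
  exact ⟨_, q, hq, hd⟩

theorem isUnit_aeval (h : CyclicFrame K e X) {q : Polynomial K} (hq : ¬ Polynomial.X ∣ q) :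
    IsUnit (Polynomial.aeval X q) := by
  rw [Polynomial.X_dvd_iff] at hq
  have hc : Commute X (Polynomial.aeval X q.divX) := by
    simpa using (Polynomial.commute_X q.divX).map (Polynomial.aeval X)
  rw [← Polynomial.X_mul_divX_add q, map_add, map_mul, Polynomial.aeval_X, Polynomial.aeval_C]
  refine IsNilpotent.isUnit_add_right_of_commute (hc.isNilpotent_mul_right h.nilpotent)
    ((IsUnit.mk0 _ hq).map _) ?_
  exact (Algebra.commutes _ _).symm

/-- Modulo the other idempotents, `y` is a polynomial in `X`. Splitting off the largest power of `X`
leaves a polynomial with nonzero constant term, which is a unit at the nilpotent `X`. For `e i * y =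
0` a vanishing power of `X` serves. -/
theorem exists_unit (h : CyclicFrame K e X) (i : ZMod n) (y : A) :
    ∃ (l : ℕ) (v : Aˣ), Commute X (v : A) ∧ e i * y = e i * X ^ l * v := by
  obtain ⟨p, hp⟩ := h.exists_aeval i y
  by_cases h0 : p = 0
  · obtain ⟨N, hN⟩ := h.nilpotent
    exact ⟨N, 1, Commute.one_right _, by simp [hp, h0, hN]⟩
  · obtain ⟨r, q, hq, hd⟩ := exists_eq_X_pow_mul h0
    obtain ⟨v, hv⟩ := h.isUnit_aeval hd
    refine ⟨r, v, ?_, ?_⟩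
    · rw [hv]
      simpa using (Polynomial.commute_X q).map (Polynomial.aeval X)
    · rw [hp, hq, map_mul, map_pow, Polynomial.aeval_X, hv, mul_assoc]

theorem isUnit_one_sub (h : CyclicFrame K e X) {v : A} (hv : Commute X v) {r : ℕ} (hr : r ≠ 0) :
    IsUnit (1 - X ^ r * v) :=
  ((hv.pow_left r).isNilpotent_mul_right (h.nilpotent.pow_of_pos hr)).isUnit_one_sub

theorem mul_pow_mul_eq (h : CyclicFrame K e X) (i : ZMod n) (l : ℕ) (y : A) :
    ∃ (r : ℕ) (v : Aˣ), Commute X (v : A) ∧ e (i + l) * y = e (i + l) * X ^ r * v ∧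
      e i * X ^ l * y = e i * X ^ (l + r) * v := by
  obtain ⟨r, v, hv, hy⟩ := h.exists_unit (i + l) y
  refine ⟨r, v, hv, hy, ?_⟩
  rw [← h.mul_pow_mul i l, mul_assoc, hy, ← mul_assoc, ← mul_assoc, h.mul_pow_mul, mul_assoc (e i),
    ← pow_add]

/-- A form of Nakayama's lemma: the equation says that a unit `1 - X ^ (r + 1) * v` annihilates `e i
* X ^ l`. -/
theorem eq_zero_of_eq_mul (h : CyclicFrame K e X) {i : ZMod n} {l : ℕ} {w : A}
    (hw : e i * X ^ l = e i * X ^ (l + 1) * w) : e i * X ^ l = 0 := by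
  obtain ⟨r, v, hv, -, hr⟩ := h.mul_pow_mul_eq i (l + 1) w
  have hu := h.isUnit_one_sub hv (Nat.succ_ne_zero r)
  refine hu.mul_left_eq_zero.1 ?_
  rw [mul_sub, mul_one, sub_eq_zero, ← mul_assoc, mul_assoc (e i), ← pow_add]
  rw [hr] at hw
  rw [hw]
  congr 3
  omega

theorem mul_pow_eq_zero_iff (h : CyclicFrame K e X) {i : ZMod n} {l : ℕ} :
    e i * X ^ l = 0 ↔ frameLength e X i ≤ l := by
  have hne : {l : ℕ | e i * X ^ l = 0}.Nonempty := by
    obtain ⟨N, hN⟩ := h.nilpotent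
    exact ⟨N, by simp [hN]⟩
  refine ⟨fun hl => Nat.sInf_le hl, fun hl => ?_⟩
  have h0 : e i * X ^ frameLength e X i = 0 := Nat.sInf_mem hne
  rw [← Nat.add_sub_cancel' hl, pow_add, ← mul_assoc, h0, zero_mul]

theorem two_le (h : CyclicFrame K e X) (i : ZMod n) : 2 ≤ frameLength e X i := by
  by_contra hc
  refine h.mul_X_ne_zero i ?_
  rw [← pow_one X]
  exact h.mul_pow_eq_zero_iff.2 (by omega)

/-- `e i X ^ l A` is a quotient of `e (i + l) A`, so it cannot be longer. -/
theorem le_add (h : CyclicFrame K e X) (i : ZMod n) (l : ℕ) :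
    frameLength e X i ≤ l + frameLength e X (i + l) := by
  rw [← h.mul_pow_eq_zero_iff, pow_add, ← mul_assoc, h.mul_pow, mul_assoc,
    h.mul_pow_eq_zero_iff.2 le_rfl, mul_zero]

theorem eq_sum (h : CyclicFrame K e X) (y : A) : y = ∑ i, e i * y := by
  rw [← Finset.sum_mul, h.sum_eq_one, one_mul]

theorem exists_mul_ne_zero (h : CyclicFrame K e X) {y : A} (hy : y ≠ 0) : ∃ i, e i * y ≠ 0 := by
  by_contra! hc
  exact hy (by rw [h.eq_sum y]; simp [hc])

theorem moduleFinite (h : CyclicFrame K e X) : Module.Finite K A := by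
  obtain ⟨N, hN⟩ := h.nilpotent
  classical
  refine ⟨⟨(Finset.univ ×ˢ Finset.range N).image fun p : ZMod n × ℕ => e p.1 * X ^ p.2, ?_⟩⟩
  rw [eq_top_iff]
  intro a _
  refine Submodule.span_le.2 ?_ (h.mem_span a)
  rintro _ ⟨⟨i, l⟩, rfl⟩
  by_cases hl : l < N
  · exact Submodule.subset_span (by
      simp only [Finset.coe_image, Set.mem_image]
      exact ⟨(i, l), by simpa using hl, rfl⟩)
  · have : X ^ l = 0 := pow_eq_zero_of_le (not_lt.1 hl) hN
    simp [this]

/-- Since `A X ⊆ X A`, powers of `y * X` lie in `X ^ k A`. Therefore `y * X` is nilpotent for every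
`y`, which puts `X` in the Jacobson radical. -/
theorem mul_X_left (h : CyclicFrame K e X) (y : A) : ∃ z, y * X = X * z := by
  have : ∀ i, ∃ z, e i * (y * X) = X * z := by
    intro i
    obtain ⟨r, v, hv, hy⟩ := h.exists_unit i y
    refine ⟨e (i + 1) * X ^ r * v, ?_⟩
    rw [← mul_assoc, hy, mul_assoc, ← hv.eq, ← mul_assoc, mul_assoc (e i), ← pow_succ, pow_succ',
      ← mul_assoc (e i), h.mul_X]
    simp only [mul_assoc]
  choose z hz using this
  refine ⟨∑ i, z i, ?_⟩
  rw [h.eq_sum (y * X), Finset.mul_sum]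
  exact Finset.sum_congr rfl fun i _ => hz i

theorem mul_X_pow_left (h : CyclicFrame K e X) (y : A) (k : ℕ) : ∃ z, y * X ^ k = X ^ k * z := by
  induction k with
  | zero => exact ⟨y, by simp⟩
  | succ k ih =>
    obtain ⟨z, hz⟩ := ih
    obtain ⟨w, hw⟩ := h.mul_X_left z
    exact ⟨w, by rw [pow_succ, ← mul_assoc, hz, mul_assoc, hw, mul_assoc]⟩

theorem X_mem_jacobson (h : CyclicFrame K e X) : X ∈ Ring.jacobson A := by
  have hpow : ∀ (y : A) (k : ℕ), ∃ z, (y * X) ^ k = X ^ k * z := by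
    intro y k
    induction k with
    | zero => exact ⟨1, by simp⟩
    | succ k ih =>
      obtain ⟨z, hz⟩ := ih
      obtain ⟨w, hw⟩ := h.mul_X_pow_left y (k + 1)
      refine ⟨w * z, ?_⟩
      rw [pow_succ', hz, ← mul_assoc, ← mul_assoc, ← hw, pow_succ' X]
      simp only [mul_assoc]
  obtain ⟨N, hN⟩ := h.nilpotent
  rw [← Ideal.jacobson_bot, Ideal.mem_jacobson_iff]
  intro y
  obtain ⟨z, hz⟩ := hpow y N
  have hnil : IsNilpotent (y * X) := ⟨N, by rw [hz, hN, zero_mul]⟩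
  obtain ⟨u, hu⟩ := hnil.isUnit_add_one
  refine ⟨(u⁻¹ : Aˣ), ?_⟩
  have := u.inv_mul
  rw [hu, mul_add, mul_one, ← mul_assoc] at this
  rw [this, sub_self]
  exact Submodule.zero_mem _

theorem X_pow_mem_jacobson (h : CyclicFrame K e X) {m : ℕ} (hm : m ≠ 0) :
    X ^ m ∈ Ring.jacobson A := by
  obtain ⟨k, rfl⟩ := Nat.exists_eq_succ_of_ne_zero hm
  rw [pow_succ]
  exact Ideal.mul_mem_left _ _ h.X_mem_jacobson

theorem mul_aeval_eq_zero_iff (h : CyclicFrame K e X) {i : ZMod n} {p : Polynomial K} :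
    e i * Polynomial.aeval X p = 0 ↔ Polynomial.X ^ frameLength e X i ∣ p := by
  constructor
  · intro hp
    by_cases h0 : p = 0
    · simp [h0]
    obtain ⟨r, q, hq, hd⟩ := exists_eq_X_pow_mul h0
    rw [hq, map_mul, map_pow, Polynomial.aeval_X, ← mul_assoc,
      (h.isUnit_aeval hd).mul_left_eq_zero, h.mul_pow_eq_zero_iff] at hp
    rw [hq]
    exact (pow_dvd_pow _ hp).mul_right _
  · rintro ⟨q, rfl⟩
    rw [map_mul, map_pow, Polynomial.aeval_X, ← mul_assoc, h.mul_pow_eq_zero_iff.2 le_rfl, zero_mul]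

/-- Evaluation at `X` identifies `e i A` with `K[X] / (X ^ c)`, where `c` is the frame length; this
links frame lengths to the Kupisch series. -/
theorem finrank_range_mulLeft (h : CyclicFrame K e X) (i : ZMod n) :
    Module.finrank K (LinearMap.range (LinearMap.mulLeft K (e i))) = frameLength e X i := by
  let g : Polynomial K →ₗ[K] A := LinearMap.mulLeft K (e i) ∘ₗ (Polynomial.aeval X).toLinearMap
  have hr : LinearMap.range (LinearMap.mulLeft K (e i)) = LinearMap.range g := by
    refine le_antisymm ?_ (LinearMap.range_comp_le_range _ _)
    rintro _ ⟨y, rfl⟩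
    obtain ⟨p, hp⟩ := h.exists_aeval i y
    exact ⟨p, hp.symm⟩
  have hk : LinearMap.ker g = (Ideal.span {(Polynomial.X : Polynomial K) ^ frameLength e X i}
      ).restrictScalars K := by
    ext p
    rw [LinearMap.mem_ker, Submodule.restrictScalars_mem, Ideal.mem_span_singleton]
    exact h.mul_aeval_eq_zero_iff
  rw [hr, ← g.quotKerEquivRange.finrank_eq, (Submodule.quotEquivOfEq _ _ hk).finrank_eq]
  exact (finrank_quotient_span_eq_natDegree).trans (Polynomial.natDegree_X_pow _)

end CyclicFrame

/-! ### Projective dimension along short exact sequences -/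

open CategoryTheory in
/-- The `R`-module `M` has projective dimension less than `d`. -/
abbrev ProjDimLT (R : Type v) [Ring R] (M : Type v) [AddCommGroup M] [Module R M] (d : ℕ) : Prop :=
  HasProjectiveDimensionLT (ModuleCat.of R M) d

namespace ProjDimLT

variable {R : Type v} [Ring R] {M : Type v} [AddCommGroup M] [Module R M]

theorem of_le {d d' : ℕ} (hM : ProjDimLT R M d) (h : d ≤ d') : ProjDimLT R M d' :=
  CategoryTheory.hasProjectiveDimensionLT_of_ge _ d d' h

theorem of_subsingleton [Subsingleton M] (d : ℕ) : ProjDimLT R M d :=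
  of_le ((ModuleCat.isZero_of_subsingleton _).hasProjectiveDimensionLT_zero) (Nat.zero_le d)

theorem one_iff : ProjDimLT R M 1 ↔ Module.Projective R M := by
  rw [IsProjective.iff_projective, CategoryTheory.projective_iff_hasProjectiveDimensionLT_one]

section

variable {L P : Type v} [AddCommGroup L] [Module R L] [AddCommGroup P] [Module R P]
  {f : L →ₗ[R] P} {g : P →ₗ[R] M}

theorem shortExact (hf : Function.Injective f) (hfg : Function.Exact f g)
    (hg : Function.Surjective g) :
    (CategoryTheory.ShortComplex.mk (ModuleCat.ofHom f) (ModuleCat.ofHom g)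
      (by ext x; exact hfg.apply_apply_eq_zero x)).ShortExact :=
  ModuleCat.shortComplex_shortExact _ hfg hf hg

theorem extension (hf : Function.Injective f) (hfg : Function.Exact f g)
    (hg : Function.Surjective g) {d : ℕ} (hL : ProjDimLT R L d) (hM : ProjDimLT R M d) :
    ProjDimLT R P d :=
  (shortExact hf hfg hg).hasProjectiveDimensionLT_X₂ d hL hM

theorem succ_of_exact [hP : Module.Projective R P] (hf : Function.Injective f)
    (hfg : Function.Exact f g) (hg : Function.Surjective g) {d : ℕ} (hL : ProjDimLT R L d) :
    ProjDimLT R M (d + 1) :=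
  (shortExact hf hfg hg).hasProjectiveDimensionLT_X₃ d hL (of_le (one_iff.2 hP) (by omega : 1 ≤ d + 1))

/-- The case `d = 0` has to be excluded: for projective `M` the sequence splits, but `L` need not
vanish. -/
theorem of_exact [hP : Module.Projective R P] (hf : Function.Injective f)
    (hfg : Function.Exact f g) (hg : Function.Surjective g) {d : ℕ} (hd : d ≠ 0)
    (hM : ProjDimLT R M (d + 1)) : ProjDimLT R L d :=
  (shortExact hf hfg hg).hasProjectiveDimensionLT_X₁ d (of_le (one_iff.2 hP) (by omega : 1 ≤ d)) hM

end

section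

variable {B : Type v} [AddCommGroup B] [Module R B] {N P : Submodule R B} {g : P →ₗ[R] M}

theorem exact_inclusion (hNP : N ≤ P) (hk : ∀ y : P, g y = 0 ↔ (y : B) ∈ N) :
    Function.Exact (Submodule.inclusion hNP) g := by
  intro y
  rw [hk]
  exact ⟨fun hy => ⟨⟨y, hy⟩, rfl⟩, by rintro ⟨x, rfl⟩; exact x.2⟩

theorem succ_of_submodule (hP : Module.Projective R P) (hNP : N ≤ P)
    (hg : Function.Surjective g) (hk : ∀ y : P, g y = 0 ↔ (y : B) ∈ N) {d : ℕ}
    (hN : ProjDimLT R N d) : ProjDimLT R M (d + 1) :=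
  succ_of_exact (Submodule.inclusion_injective hNP) (exact_inclusion hNP hk) hg hN

theorem of_submodule (hP : Module.Projective R P) (hNP : N ≤ P)
    (hg : Function.Surjective g) (hk : ∀ y : P, g y = 0 ↔ (y : B) ∈ N) {d : ℕ} (hd : d ≠ 0)
    (hM : ProjDimLT R M (d + 1)) : ProjDimLT R N d :=
  of_exact (Submodule.inclusion_injective hNP) (exact_inclusion hNP hk) hg hd hM

end

/-- A bound for the projective dimensions of the simple modules is one for the modules of finite
length. -/
theorem of_isFiniteLength {d : ℕ}
    (hs : ∀ (T : Type v) [AddCommGroup T] [Module R T] [IsSimpleModule R T], ProjDimLT R T d)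
    (hM : IsFiniteLength R M) : ProjDimLT R M d := by
  induction hM with
  | of_subsingleton => exact of_subsingleton d
  | @of_simple_quotient M _ _ N _ _ ih =>
    exact extension (f := N.subtype) (g := N.mkQ) N.injective_subtype
      (LinearMap.exact_subtype_mkQ N) N.mkQ_surjective ih (hs _)

end ProjDimLT

/-! ### The right ideals `e i X ^ l A`, their covers and syzygies -/

/-- Left multiplication as a map of right modules. -/
def rightModuleMulLeft {A : Type*} [Ring A] (a : A) : A →ₗ[Aᵐᵒᵖ] A where
  toFun y := a * y
  map_add' := mul_add a
  map_smul' r y := (mul_assoc a y r.unop).symm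

/-- The regular right module as the regular module of the opposite ring. -/
def opRightModuleEquiv (A : Type*) [Ring A] : A ≃ₗ[Aᵐᵒᵖ] Aᵐᵒᵖ where
  toFun := MulOpposite.op
  invFun := MulOpposite.unop
  map_add' _ _ := rfl
  map_smul' _ _ := rfl

/-- The right ideal `a A`. -/
def principalRightIdeal {A : Type*} [Ring A] (a : A) : Submodule Aᵐᵒᵖ A :=
  LinearMap.range (rightModuleMulLeft a)

namespace CyclicFrame

section

variable {n : ℕ} {A : Type v} [Ring A] {e : ZMod n → A} {X : A}

theorem principalRightIdeal_mul_pow_le (i : ZMod n) (l : ℕ) :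
    principalRightIdeal (e i * X ^ l) ≤ principalRightIdeal (e i) := by
  rintro _ ⟨b, rfl⟩
  exact ⟨X ^ l * b, (mul_assoc _ _ _).symm⟩

theorem mul_unit_mem {i : ZMod n} {r m : ℕ} (hr : m ≤ r) (v : A) :
    e i * X ^ r * v ∈ principalRightIdeal (e i * X ^ m) :=
  ⟨X ^ (r - m) * v, by
    change e i * X ^ m * (X ^ (r - m) * v) = _
    rw [← mul_assoc, mul_assoc (e i), ← pow_add, Nat.add_sub_cancel' hr]⟩

/-- Left multiplication by `e i * X ^ l` on the projective module `e (i + l) A`. -/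
def cover (e : ZMod n → A) (X : A) (i : ZMod n) (l : ℕ) :
    principalRightIdeal (e (i + l)) →ₗ[Aᵐᵒᵖ] principalRightIdeal (e i * X ^ l) :=
  (rightModuleMulLeft (e i * X ^ l)).rangeRestrict ∘ₗ (principalRightIdeal (e (i + l))).subtype

theorem coe_cover (i : ZMod n) (l : ℕ) (y : principalRightIdeal (e (i + l))) :
    (cover e X i l y : A) = e i * X ^ l * y := rfl

end

variable {K : Type u} [Field K] {n : ℕ} [NeZero n] {A : Type v} [Ring A] [Algebra K A]
  {e : ZMod n → A} {X : A}

theorem projective_principalRightIdeal (h : CyclicFrame K e X) (i : ZMod n) :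
    Module.Projective Aᵐᵒᵖ (principalRightIdeal (e i)) := by
  have : Module.Projective Aᵐᵒᵖ A := Module.Projective.of_equiv (opRightModuleEquiv A).symm
  refine Module.Projective.of_split (principalRightIdeal (e i)).subtype
    (rightModuleMulLeft (e i)).rangeRestrict ?_
  ext ⟨_, b, rfl⟩
  change e i * (e i * b) = e i * b
  rw [← mul_assoc, h.mul_self]

theorem mul_of_mem (h : CyclicFrame K e X) {i : ZMod n} {y : A}
    (hy : y ∈ principalRightIdeal (e i)) : e i * y = y := by
  obtain ⟨b, rfl⟩ := hy
  change e i * (e i * b) = e i * b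
  rw [← mul_assoc, h.mul_self]

theorem cover_surjective (h : CyclicFrame K e X) (i : ZMod n) (l : ℕ) :
    Function.Surjective (cover e X i l) := by
  rintro ⟨_, b, rfl⟩
  refine ⟨⟨e (i + l) * b, b, rfl⟩, Subtype.ext ?_⟩
  rw [coe_cover, ← mul_assoc, h.mul_pow_mul]
  rfl

/-- An element `e (i + l) X ^ r v` is sent to `e i X ^ (l + r) v`, which vanishes exactly when `l +
r` reaches the frame length. The truncated subtraction is harmless: for larger `l` the kernel is
everything. -/
theorem cover_eq_zero_iff (h : CyclicFrame K e X) (i : ZMod n) (l : ℕ)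
    (y : principalRightIdeal (e (i + l))) : cover e X i l y = 0 ↔
      (y : A) ∈ principalRightIdeal (e (i + l) * X ^ (frameLength e X i - l)) := by
  rw [← Submodule.coe_eq_zero, coe_cover]
  constructor
  · intro hy
    obtain ⟨r, v, -, hr, hs⟩ := h.mul_pow_mul_eq i l y
    rw [hs, v.isUnit.mul_left_eq_zero, h.mul_pow_eq_zero_iff] at hy
    rw [← h.mul_of_mem y.2, hr]
    exact mul_unit_mem (by omega) _
  · rintro ⟨b, hb⟩
    rw [← hb]
    change e i * X ^ l * (e (i + l) * X ^ (frameLength e X i - l) * b) = 0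
    rw [← mul_assoc, ← mul_assoc, h.mul_pow_mul, mul_assoc (e i), ← pow_add,
      h.mul_pow_eq_zero_iff.2 (by omega), zero_mul]

theorem projDimLT_of_syzygy (h : CyclicFrame K e X) {i : ZMod n} {l d : ℕ}
    (hd : ProjDimLT Aᵐᵒᵖ
      (principalRightIdeal (e (i + l) * X ^ (frameLength e X i - l))) d) :
    ProjDimLT Aᵐᵒᵖ (principalRightIdeal (e i * X ^ l)) (d + 1) :=
  .succ_of_submodule (h.projective_principalRightIdeal _) (principalRightIdeal_mul_pow_le _ _)
    (h.cover_surjective i l) (h.cover_eq_zero_iff i l) hd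

theorem projDimLT_syzygy (h : CyclicFrame K e X) {i : ZMod n} {l d : ℕ} (h0 : d ≠ 0)
    (hd : ProjDimLT Aᵐᵒᵖ (principalRightIdeal (e i * X ^ l)) (d + 1)) :
    ProjDimLT Aᵐᵒᵖ (principalRightIdeal (e (i + l) * X ^ (frameLength e X i - l))) d :=
  .of_submodule (h.projective_principalRightIdeal _) (principalRightIdeal_mul_pow_le _ _)
    (h.cover_surjective i l) (h.cover_eq_zero_iff i l) h0 hd

theorem projDimLT_of_le (h : CyclicFrame K e X) {i : ZMod n} {l : ℕ} (hl : frameLength e X i ≤ l)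
    (d : ℕ) : ProjDimLT Aᵐᵒᵖ (principalRightIdeal (e i * X ^ l)) d := by
  have : Subsingleton (principalRightIdeal (e i * X ^ l)) := by
    refine ⟨fun x y => Subtype.ext ?_⟩
    obtain ⟨_, b, rfl⟩ := x
    obtain ⟨_, c, rfl⟩ := y
    change e i * X ^ l * b = e i * X ^ l * c
    rw [h.mul_pow_eq_zero_iff.2 hl, zero_mul, zero_mul]
  exact .of_subsingleton d

/-- The simple right modules are the tops of the modules `e i A`. -/
theorem projDimLT_of_isSimpleModule (h : CyclicFrame K e X) (T : Type v) [AddCommGroup T]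
    [Module Aᵐᵒᵖ T] [IsSimpleModule Aᵐᵒᵖ T] : ∃ i, ∀ d,
      ProjDimLT Aᵐᵒᵖ (principalRightIdeal (e i * X ^ 1)) d → ProjDimLT Aᵐᵒᵖ T (d + 1) := by
  have := IsSimpleModule.nontrivial Aᵐᵒᵖ T
  obtain ⟨t, ht⟩ := exists_ne (0 : T)
  obtain ⟨i, hi⟩ : ∃ i, MulOpposite.op (e i) • t ≠ 0 := by
    by_contra! hc
    refine ht ?_
    rw [← one_smul Aᵐᵒᵖ t, ← MulOpposite.op_one, ← h.sum_eq_one, Finset.op_sum, Finset.sum_smul]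
    exact Finset.sum_eq_zero fun i _ => hc i
  refine ⟨i, fun d hd => ?_⟩
  let g : principalRightIdeal (e i) →ₗ[Aᵐᵒᵖ] T :=
    LinearMap.toSpanSingleton Aᵐᵒᵖ T t ∘ₗ (opRightModuleEquiv A).toLinearMap ∘ₗ
      (principalRightIdeal (e i)).subtype
  have hg : ∀ y, g y = MulOpposite.op (y : A) • t := fun _ => rfl
  have hei : e i ∈ principalRightIdeal (e i) := ⟨1, mul_one _⟩
  have hsurj : Function.Surjective g := by
    refine (LinearMap.surjective_or_eq_zero g).resolve_right fun h0 => hi ?_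
    rw [← hg ⟨e i, hei⟩, h0, LinearMap.zero_apply]
  -- Otherwise `t e_i X` generates the simple module, so `t e_i = t e_i X b`, and a unit `1 - X ^ (1
  -- + r) * v` would kill `t e_i`.
  have hX : g ⟨e i * X, X, rfl⟩ = 0 := by
    by_contra hne
    obtain ⟨b, hb⟩ := (IsSimpleModule.toSpanSingleton_surjective Aᵐᵒᵖ hne)
      (MulOpposite.op (e i) • t)
    rw [LinearMap.toSpanSingleton_apply, hg, smul_smul] at hb
    obtain ⟨r, v, hv, -, hr⟩ := h.mul_pow_mul_eq i 1 b.unop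
    rw [pow_one] at hr
    have hb' : MulOpposite.op (1 - X ^ (1 + r) * v) • MulOpposite.op (e i) • t = 0 := by
      rw [smul_smul, ← MulOpposite.op_mul, mul_sub, mul_one, ← mul_assoc, ← hr, MulOpposite.op_sub,
        sub_smul, ← hb, sub_eq_zero]
      rfl
    have hu := (h.isUnit_one_sub hv (by omega : 1 + r ≠ 0)).op
    exact hi ((hu.smul_eq_zero).1 hb')
  refine .succ_of_submodule (h.projective_principalRightIdeal i)
    (principalRightIdeal_mul_pow_le i 1) hsurj (fun y => ?_) hd
  constructor
  · intro hy
    obtain ⟨r, v, -, hr⟩ := h.exists_unit i y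
    rw [h.mul_of_mem y.2] at hr
    rw [hr]
    refine mul_unit_mem ?_ _
    by_contra hr0
    obtain rfl : r = 0 := by omega
    rw [hg, hr, pow_zero, mul_one, MulOpposite.op_mul, mul_smul] at hy
    exact hi ((v.isUnit.op.smul_eq_zero).1 hy)
  · rintro ⟨b, hb⟩
    have : y = MulOpposite.op b • (⟨e i * X, X, rfl⟩ : principalRightIdeal (e i)) :=
      Subtype.ext (by rw [← hb]; change e i * X ^ 1 * b = e i * X * b; rw [pow_one])
    rw [this, map_smul, hX, smul_zero]

/-- A right-linear map onto `e i X ^ l A ≠ 0` from a projective module. -/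
theorem add_le_of_projective (h : CyclicFrame K e X) {M : Type*} [AddCommGroup M]
    [Module Aᵐᵒᵖ M] [Module.Projective Aᵐᵒᵖ M] (g : M →ₗ[Aᵐᵒᵖ] A) {i : ZMod n} {l : ℕ}
    (hl : l < frameLength e X i) (hg : ∀ m, g m ∈ principalRightIdeal (e i * X ^ l)) (y : M)
    (hy : g y = e i * X ^ l)
    (hy0 : MulOpposite.op (X ^ (frameLength e X i - l)) • y = 0) :
    l + frameLength e X (i + l) ≤ frameLength e X i := by
  -- Lift `g` through the surjection `A → e i X ^ l A`. The lift `s y` inherits the annihilator of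
  -- `y`, and it generates the top of `e (i + l) A` because its exponent `r` is zero.
  obtain ⟨s, hs⟩ := Module.projective_lifting_property
    (rightModuleMulLeft (e i * X ^ l)).rangeRestrict (g.codRestrict _ hg)
    (LinearMap.surjective_rangeRestrict _)
  have hu : e i * X ^ l * s y = e i * X ^ l := by
    exact (congrArg Subtype.val (LinearMap.congr_fun hs y)).trans hy
  obtain ⟨r, v, hv, hr, hr'⟩ := h.mul_pow_mul_eq i l (s y)
  have hr0 : r = 0 := by
    by_contra hr0
    have hne : e i * X ^ l ≠ 0 := fun h0 => by
      have := h.mul_pow_eq_zero_iff.1 h0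
      omega
    refine hne (((h.isUnit_one_sub hv hr0).mul_left_eq_zero).1 ?_)
    rw [mul_sub, mul_one, ← mul_assoc, mul_assoc (e i), ← pow_add, ← hr', hu, sub_self]
  have hs0 : s y * X ^ (frameLength e X i - l) = 0 := by
    have := congrArg s hy0
    rw [map_smul, map_zero] at this
    exact this
  have h0 : e (i + l) * X ^ (frameLength e X i - l) = 0 := by
    rw [← v.isUnit.mul_left_eq_zero, mul_assoc, (hv.pow_left _).eq, ← mul_assoc]
    rw [hr0, pow_zero, mul_one] at hr
    rw [← hr, mul_assoc, hs0, mul_zero]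
  have := h.mul_pow_eq_zero_iff.1 h0
  omega

theorem add_le_of_projDimLT_one (h : CyclicFrame K e X) {i : ZMod n} {l : ℕ}
    (hl : l < frameLength e X i)
    (hp : ProjDimLT Aᵐᵒᵖ (principalRightIdeal (e i * X ^ l)) 1) :
    l + frameLength e X (i + l) ≤ frameLength e X i := by
  have := ProjDimLT.one_iff.1 hp
  refine h.add_le_of_projective (principalRightIdeal (e i * X ^ l)).subtype hl (fun m => m.2)
    ⟨e i * X ^ l, 1, mul_one _⟩ rfl (Subtype.ext ?_)
  change e i * X ^ l * X ^ (frameLength e X i - l) = 0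
  rw [mul_assoc, ← pow_add, h.mul_pow_eq_zero_iff]
  omega

end CyclicFrame

/-! ### Lengths forced by a heredity ideal -/

namespace CyclicFrame

section

variable {n : ℕ} {A : Type v} [Ring A] {e : ZMod n → A} {X : A} {H : TwoSidedIdeal A}

theorem mul_pow_mem_of_eq {i : ZMod n} {y : A} {r : ℕ} {v : Aˣ} (hy : y ∈ H)
    (hv : y = e i * X ^ r * v) : e i * X ^ r ∈ H := by
  have := H.mul_mem_right y ((v⁻¹ : Aˣ) : A) hy
  rwa [hv, Units.mul_inv_cancel_right] at this

theorem exists_minimal_pow_mem {k : ZMod n} {d : ℕ} (hd : e k * X ^ d ∈ H) :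
    ∃ l ≤ d, e k * X ^ l ∈ H ∧ ∀ m < l, e k * X ^ m ∉ H := by
  classical
  have hex : ∃ l, e k * X ^ l ∈ H := ⟨d, hd⟩
  exact ⟨Nat.find hex, Nat.find_min' hex hd, Nat.find_spec hex, fun m hm => Nat.find_min hex hm⟩

theorem frameLength_map {K : Type*} [Field K] [Algebra K A] {B : Type*} [Ring B] [Algebra K B]
     (ψ : A →ₐ[K] B)
    (hψ : Function.Injective ψ) (i : ZMod n) :
    frameLength (fun i => ψ (e i)) (ψ X) i = frameLength e X i := by
  simp only [frameLength, ← map_pow, ← map_mul, map_eq_zero_iff ψ hψ]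

end

variable {K : Type u} [Field K] {n : ℕ} [NeZero n] {A : Type v} [Ring A] [Algebra K A]
  {e : ZMod n → A} {X : A} {H : TwoSidedIdeal A}

/-- If the generator `e k * X ^ h` of `e k H` is nonzero, then `e (k + h)` belongs to the idempotent
ideal `H`. -/
theorem idempotent_mem (h : CyclicFrame K e X) (hH : H.asIdeal * H.asIdeal = H.asIdeal)
    {k : ZMod n} {l : ℕ} (hl : e k * X ^ l ∈ H) (hmin : ∀ m < l, e k * X ^ m ∉ H)
    (h0 : e k * X ^ l ≠ 0) : e (k + l) ∈ H := by
  by_contra hne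
  -- If `e (k + l) ∉ H`, the first factor of a product in `H * H` contributes at least `X ^ l` and
  -- the second at least one more `X`. As `H * H = H`, the generator `e k X ^ l` would lie in `e k X
  -- ^ (l + 1) A`.
  have key : ∀ y ∈ H.asIdeal * H.asIdeal, ∃ w, e k * y = e k * X ^ (l + 1) * w := by
    intro y hy
    refine Submodule.mul_induction_on hy (fun a ha b hb => ?_) fun a b ha hb => ?_
    · rw [TwoSidedIdeal.mem_asIdeal] at ha hb
      obtain ⟨r, v, -, hr⟩ := h.exists_unit k a
      have hlr : l ≤ r := by
        by_contra hc
        exact hmin r (by omega) (mul_pow_mem_of_eq (H.mul_mem_left (e k) a ha) hr)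
      obtain ⟨s, rfl⟩ := Nat.exists_eq_add_of_le hlr
      obtain ⟨t, w, -, ht, ht'⟩ := h.mul_pow_mul_eq k l (X ^ s * v * b)
      have ht0 : t ≠ 0 := by
        rintro rfl
        have := mul_pow_mem_of_eq
          (H.mul_mem_left (e (k + l)) _ (H.mul_mem_left (X ^ s * v) b hb)) ht
        rw [pow_zero, mul_one] at this
        exact hne this
      obtain ⟨t, rfl⟩ := Nat.exists_eq_succ_of_ne_zero ht0
      refine ⟨X ^ t * w, ?_⟩
      rw [← mul_assoc, hr, pow_add]
      simp only [mul_assoc] at ht' ⊢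
      rw [ht', ← mul_assoc (X ^ (l + 1)), ← pow_add]
      congr 3
      omega
    · obtain ⟨w, hw⟩ := ha
      obtain ⟨w', hw'⟩ := hb
      exact ⟨w + w', by rw [mul_add, hw, hw', mul_add]⟩
  rw [hH] at key
  obtain ⟨w, hw⟩ := key _ (TwoSidedIdeal.mem_asIdeal.2 hl)
  rw [h.mul_mul_pow] at hw
  exact h0 (h.eq_zero_of_eq_mul hw)

theorem mul_pow_eq_zero_of_isHeredityIdeal (h : CyclicFrame K e X) (hH : IsHeredityIdeal H)
    {i : ZMod n} {l : ℕ} (hl : l ≠ 0) (hi : e i ∈ H) (hj : e (i + l) ∈ H) : e i * X ^ l = 0 := by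
  rw [← h.mul_pow_mul]
  exact hH.mul_jacobson_mul _ hi _ (h.X_pow_mem_jacobson hl) _ hj

/-- By minimality of `l`, left multiplication by `e k` maps the projective module `H` onto `e k X ^
l A`, so the lifting argument of `add_le_of_projective` applies to `H` itself. -/
theorem le_add_of_isHeredityIdeal (h : CyclicFrame K e X) (hH : IsHeredityIdeal H)
    {k : ZMod n} {l : ℕ} (hl : e k * X ^ l ∈ H) (hmin : ∀ m < l, e k * X ^ m ∉ H)
    (h0 : e k * X ^ l ≠ 0) : l + frameLength e X (k + l) ≤ frameLength e X k := by
  have := hH.projective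
  have hlt : l < frameLength e X k := by
    by_contra hc
    exact h0 (h.mul_pow_eq_zero_iff.2 (not_lt.1 hc))
  refine h.add_le_of_projective (rightModuleMulLeft (e k) ∘ₗ
      (opRightModuleEquiv A).symm.toLinearMap ∘ₗ H.subtypeMop) hlt (fun y => ?_)
    ⟨e k * X ^ l, hl⟩ (h.mul_mul_pow k l) (Subtype.ext ?_)
  · obtain ⟨r, v, -, hr⟩ := h.exists_unit k (y : A)
    have hlr : l ≤ r := by
      by_contra hc
      exact hmin r (by omega) (mul_pow_mem_of_eq (H.mul_mem_left (e k) _ y.2) hr)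
    change e k * (y : A) ∈ _
    rw [hr]
    exact mul_unit_mem hlr (v : A)
  · change e k * X ^ l * X ^ (frameLength e X k - l) = 0
    rw [mul_assoc, ← pow_add, h.mul_pow_eq_zero_iff]
    omega

/-- The shape of the lengths forced by a nonzero heredity ideal. -/
theorem exists_of_isHeredityIdeal (h : CyclicFrame K e X) (hH : IsHeredityIdeal H) (hne : H ≠ ⊥) :
    ∃ i, frameLength e X i ≤ n ∧ ∀ (k : ZMod n) (d : ℕ), d < n → k + d = i →
      frameLength e X k ≤ d ∨ frameLength e X k = d + frameLength e X i := by
  obtain ⟨i, hi⟩ : ∃ i, e i ∈ H := by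
    obtain ⟨y, hy, hy0⟩ : ∃ y ∈ H, y ≠ 0 := by
      by_contra! hc
      exact hne (TwoSidedIdeal.ext fun x =>
        ⟨fun hx => by rw [TwoSidedIdeal.mem_bot]; exact hc x hx, fun hx => by
          rw [TwoSidedIdeal.mem_bot] at hx; rw [hx]; exact H.zero_mem⟩)
    obtain ⟨k, hk⟩ := h.exists_mul_ne_zero hy0
    obtain ⟨r, v, -, hr⟩ := h.exists_unit k y
    obtain ⟨l, hlr, hl, hmin⟩ := exists_minimal_pow_mem
      (mul_pow_mem_of_eq (H.mul_mem_left (e k) y hy) hr)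
    refine ⟨k + l, h.idempotent_mem hH.idempotent hl hmin fun h0 => hk ?_⟩
    rw [hr, h.mul_pow_eq_zero_iff.2 ((h.mul_pow_eq_zero_iff.1 h0).trans hlr), zero_mul]
  refine ⟨i, ?_, fun k d _ hkd => ?_⟩
  · rw [← h.mul_pow_eq_zero_iff]
    exact h.mul_pow_eq_zero_of_isHeredityIdeal hH (NeZero.ne n) hi (by simpa using hi)
  · have hd : e k * X ^ d ∈ H := by
      rw [h.mul_pow, hkd]
      exact H.mul_mem_left _ _ hi
    obtain ⟨l, hld, hl, hmin⟩ := exists_minimal_pow_mem hd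
    by_cases h0 : e k * X ^ l = 0
    · exact Or.inl ((h.mul_pow_eq_zero_iff.1 h0).trans hld)
    have hle := h.le_add_of_isHeredityIdeal hH hl hmin h0
    have hge := h.le_add k l
    have hmem := h.idempotent_mem hH.idempotent hl hmin h0
    obtain ⟨m, rfl⟩ := Nat.exists_eq_add_of_le hld
    have hkm : k + l + m = i := by rw [← hkd, Nat.cast_add, add_assoc]
    -- If `l < d`, both `e (k + l)` and `e i` lie in `H`, so `H J H = 0` kills the path of length `m
    -- = d - l` between them; this bounds the length at `k` by `d`.
    by_cases hm : m = 0
    · subst hm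
      rw [Nat.cast_zero, add_zero] at hkm
      rw [← hkm]
      exact Or.inr (by omega)
    · have := h.mul_pow_eq_zero_iff.1
        (h.mul_pow_eq_zero_of_isHeredityIdeal hH hm hmem (hkm ▸ hi))
      exact Or.inl (by omega)

/-- Frames are transported along isomorphisms. -/
theorem map (h : CyclicFrame K e X) {B : Type*} [Ring B] [Algebra K B] (ψ : A →ₐ[K] B)
    (hψ : Function.Bijective ψ) : CyclicFrame K (fun i => ψ (e i)) (ψ X) where
  mul_self i := by rw [← map_mul, h.mul_self]
  mul_of_ne i j hij := by rw [← map_mul, h.mul_of_ne i j hij, map_zero]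
  sum_eq_one := by rw [← map_sum, h.sum_eq_one, map_one]
  mul_X i := by rw [← map_mul, h.mul_X, map_mul]
  nilpotent := h.nilpotent.map ψ
  mem_span b := by
    obtain ⟨a, rfl⟩ := hψ.2 b
    have := Submodule.mem_map_of_mem (f := ψ.toLinearMap) (h.mem_span a)
    rw [Submodule.map_span, ← Set.range_comp] at this
    simpa [Function.comp_def] using this
  mul_X_ne_zero i := by
    rw [← map_mul, Ne, map_eq_zero_iff ψ hψ.1]
    exact h.mul_X_ne_zero i

theorem exists_of_isQuasiHereditary (h : CyclicFrame K e X) (hA : IsQuasiHereditary A) :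
    ∃ i, frameLength e X i ≤ n ∧ ∀ (k : ZMod n) (d : ℕ), d < n → k + d = i →
      frameLength e X k ≤ d ∨ frameLength e X k = d + frameLength e X i := by
  have : Nontrivial A := ⟨⟨_, _, h.mul_X_ne_zero 0⟩⟩
  obtain ⟨m, I, hI, h0, hm, hH⟩ := hA
  have hm0 : m ≠ 0 := by
    rintro rfl
    rw [Fin.last_zero, h0] at hm
    exact bot_ne_top hm
  obtain ⟨m, rfl⟩ := Nat.exists_eq_succ_of_ne_zero hm0
  have h1 := hH 0
  have hlt : I 0 < I (Fin.succ 0) := hI (Fin.succ_pos 0)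
  rw [Fin.castSucc_zero] at h1
  -- As `I 0 = 0`, the quotient is a copy of `A`, and the first layer of the chain becomes a nonzero
  -- heredity ideal there.
  let ψ : A →ₐ[K] (I 0).ringCon.Quotient :=
    { (I 0).ringCon.mk' with commutes' := fun _ => rfl }
  have hψ : Function.Bijective ψ := by
    refine ⟨?_, RingCon.mk'_surjective _⟩
    have : TwoSidedIdeal.ker (I 0).ringCon.mk' = ⊥ := by rw [TwoSidedIdeal.ker_ringCon_mk', h0]
    exact (TwoSidedIdeal.ker_eq_bot _).1 this
  have hne : (I (Fin.succ 0)).map (I 0).ringCon.mk' ≠ ⊥ := by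
    intro hbot
    refine hlt.not_ge fun x hx => ?_
    have hx' : (I 0).ringCon.mk' x ∈ (I (Fin.succ 0)).map (I 0).ringCon.mk' :=
      TwoSidedIdeal.subset_span ⟨x, hx, rfl⟩
    rw [hbot, TwoSidedIdeal.mem_bot] at hx'
    rwa [← TwoSidedIdeal.ker_ringCon_mk' (I 0), TwoSidedIdeal.mem_ker]
  have := (h.map ψ hψ).exists_of_isHeredityIdeal h1 hne
  simpa only [frameLength_map ψ hψ.1] using this

end CyclicFrame

/-! ### Upper and lower bounds from resolutions by intervals -/

namespace CyclicFrame

variable {K : Type u} [Field K] {n : ℕ} [NeZero n] {A : Type v} [Ring A] [Algebra K A]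
  {e : ZMod n → A} {X : A}

theorem exists_eq_add_natCast (i j : ZMod n) : ∃ a < n, j = i + (a : ℕ) :=
  ⟨(j - i).val, ZMod.val_lt _, by rw [ZMod.natCast_zmod_val, add_sub_cancel]⟩

theorem add_frameLength_mono (h : CyclicFrame K e X) (i : ZMod n) {a b : ℕ} (hab : a ≤ b) :
    a + frameLength e X (i + a) ≤ b + frameLength e X (i + b) := by
  obtain ⟨m, rfl⟩ := Nat.exists_eq_add_of_le hab
  have := h.le_add (i + a) m
  rw [Nat.cast_add, ← add_assoc]
  omega

/-- The syzygy of the interval module `[b, f a)` is `[f a, f b)` for `f p = p + c (i + p)`. -/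
theorem projDimLT_interval_of_syzygy (h : CyclicFrame K e X) {i : ZMod n} {a b d : ℕ} (hab : a ≤ b)
    (hd : ProjDimLT Aᵐᵒᵖ (principalRightIdeal
      (e (i + b) * X ^ (a + frameLength e X (i + a) - b))) d) :
    ProjDimLT Aᵐᵒᵖ (principalRightIdeal (e (i + a) * X ^ (b - a))) (d + 1) := by
  refine h.projDimLT_of_syzygy ?_
  have h1 : i + (a : ZMod n) + ((b - a : ℕ) : ZMod n) = i + b := by
    rw [add_assoc, ← Nat.cast_add, Nat.add_sub_cancel' hab]
  have h2 : frameLength e X (i + a) - (b - a) = a + frameLength e X (i + a) - b := by omega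
  rwa [h1, h2]

section

variable {i : ZMod n}

/-- Induction on `n - b`: the syzygy belongs to the pair `(b, f a)`. If `f a` exceeds `n` it has its
maximal value, monotonicity of `f` gives `f b = f a`, and the syzygy is zero. -/
theorem projDimLT_interval (h : CyclicFrame K e X)
    (hq : ∀ p : ℕ, 1 ≤ p → p ≤ n → p + frameLength e X (i + p) ≤ n ∨
      p + frameLength e X (i + p) = n + frameLength e X i) {a b : ℕ}
    (ha : 1 ≤ a) (hab : a < b) (hb : b ≤ n) :
    ProjDimLT Aᵐᵒᵖ (principalRightIdeal (e (i + a) * X ^ (b - a))) (n - b + 1) := by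
  induction hN : n - b using Nat.strong_induction_on generalizing a b with
  | _ N ih =>
    by_cases hfb : a + frameLength e X (i + a) ≤ b
    · exact h.projDimLT_of_le (by omega) _
    rcases hq a ha (by omega) with hfa | hfa
    · refine (h.projDimLT_interval_of_syzygy hab.le (ih _ ?_ (by omega) (by omega) hfa rfl)).of_le
        ?_ <;> omega
    · have h0 := h.two_le i
      have hm := h.add_frameLength_mono i hab.le
      have hfb := (hq b (by omega) hb).resolve_left (by omega)
      refine (h.projDimLT_interval_of_syzygy hab.le (h.projDimLT_of_le ?_ 0)).of_le ?_ <;> omega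

/-- As long as the length is 2, the pair `(t, t + 1)` moves on to `(t + 1, t + 2)`. The first length
at least 3 makes it jump by at least two, which improves `projDimLT_interval` by one. -/
theorem projDimLT_interval_of_three_le (h : CyclicFrame K e X)
    (hq : ∀ p : ℕ, 1 ≤ p → p ≤ n → p + frameLength e X (i + p) ≤ n ∨
      p + frameLength e X (i + p) = n + frameLength e X i) {t s : ℕ} (ht : 1 ≤ t) (hts : t ≤ s)
    (hs : s + 2 ≤ n) (hc : 3 ≤ frameLength e X (i + s)) :
    ProjDimLT Aᵐᵒᵖ (principalRightIdeal (e (i + t) * X ^ (t + 1 - t))) (n - t - 1) := by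
  induction hN : s - t generalizing t with
  | zero =>
    obtain rfl : t = s := by omega
    have h0 := h.two_le i
    rcases hq t ht (by omega) with hfa | hfa
    · refine (h.projDimLT_interval_of_syzygy (by omega)
        (h.projDimLT_interval hq (by omega) (by omega) hfa)).of_le ?_
      omega
    · have hm := h.add_frameLength_mono i (Nat.le_succ t)
      have hfb := (hq (t + 1) (by omega) (by omega)).resolve_left (by
        simp only [Nat.succ_eq_add_one] at hm; omega)
      refine (h.projDimLT_interval_of_syzygy (by omega) (h.projDimLT_of_le ?_ 0)).of_le ?_ <;> omega
  | succ N ih =>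
    by_cases hc2 : frameLength e X (i + t) = 2
    · have := ih (t := t + 1) (by omega) (by omega) (by omega)
      refine (h.projDimLT_interval_of_syzygy (d := n - (t + 1) - 1) (by omega) ?_).of_le (by omega)
      have h1 : t + frameLength e X (i + t) - (t + 1) = t + 1 + 1 - (t + 1) := by omega
      rwa [h1]
    · have h0 := h.two_le i
      have h2 := h.two_le (i + t)
      rcases hq t ht (by omega) with hfa | hfa
      · refine (h.projDimLT_interval_of_syzygy (by omega)
          (h.projDimLT_interval hq (by omega) (by omega) hfa)).of_le ?_
        omega
      · have hm := h.add_frameLength_mono i (Nat.le_succ t)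
        have hfb := (hq (t + 1) (by omega) (by omega)).resolve_left (by
          simp only [Nat.succ_eq_add_one] at hm; omega)
        refine (h.projDimLT_interval_of_syzygy (by omega)
          (h.projDimLT_of_le ?_ 0)).of_le ?_ <;> omega

theorem projDimLT_radical_of_ne (h : CyclicFrame K e X)
    (hq : ∀ p : ℕ, 1 ≤ p → p ≤ n → p + frameLength e X (i + p) ≤ n ∨
      p + frameLength e X (i + p) = n + frameLength e X i) {j : ZMod n} (hj : j ≠ i) :
    ProjDimLT Aᵐᵒᵖ (principalRightIdeal (e j * X ^ 1)) (n - 1) := by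
  obtain ⟨a, ha, rfl⟩ := exists_eq_add_natCast i j
  have ha0 : a ≠ 0 := by
    rintro rfl
    simp at hj
  have := h.projDimLT_interval hq (a := a) (b := a + 1) (by omega) (by omega) (by omega)
  rw [Nat.add_sub_cancel_left] at this
  exact this.of_le (by omega)

theorem projDimLT_radical_self (h : CyclicFrame K e X) {d : ℕ}
    (hd : ProjDimLT Aᵐᵒᵖ (principalRightIdeal
      (e (i + (1 : ℕ)) * X ^ (frameLength e X i - 1))) d) :
    ProjDimLT Aᵐᵒᵖ (principalRightIdeal (e i * X ^ 1)) (d + 1) :=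
  h.projDimLT_of_syzygy hd

theorem projDimLT_radical (h : CyclicFrame K e X) (hn : frameLength e X i ≤ n)
    (hq : ∀ p : ℕ, 1 ≤ p → p ≤ n → p + frameLength e X (i + p) ≤ n ∨
      p + frameLength e X (i + p) = n + frameLength e X i) (j : ZMod n) :
    ProjDimLT Aᵐᵒᵖ (principalRightIdeal (e j * X ^ 1)) n := by
  by_cases hj : j = i
  · subst hj
    have h2 := h.two_le j
    -- The syzygy of the radical at `j` belongs to the pair `(1, c)` with `c = frameLength e X j`.
    -- This yields the bound `n - c + 2`, and `c ≥ 2`.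
    refine (h.projDimLT_radical_self (h.projDimLT_interval hq le_rfl h2 hn)).of_le ?_
    omega
  · exact (h.projDimLT_radical_of_ne hq hj).of_le (by omega)

theorem projDimLT_radical_of_not (h : CyclicFrame K e X) (hn : frameLength e X i ≤ n)
    (hq : ∀ p : ℕ, 1 ≤ p → p ≤ n → p + frameLength e X (i + p) ≤ n ∨
      p + frameLength e X (i + p) = n + frameLength e X i)
    (hK : ¬ ∃ b, frameLength e X b = 3 ∧ ∀ k ≠ b, frameLength e X k = 2) (j : ZMod n) :
    ProjDimLT Aᵐᵒᵖ (principalRightIdeal (e j * X ^ 1)) (n - 1) := by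
  by_cases hj : j = i
  · subst hj
    have h2 := h.two_le j
    by_cases h3 : frameLength e X j = 2
    · obtain ⟨s, hs1, hs, hc⟩ : ∃ s : ℕ, 1 ≤ s ∧ s + 2 ≤ n ∧ 3 ≤ frameLength e X (j + s) := by
        by_contra! hc
        -- Without such a jump only the last vertex before `j` is left. There the length is at least
        -- 2, so the first alternative of `hq` fails and the second gives `1 + 2 = 3`.
        refine hK ⟨j + (n - 1 : ℕ), ?_, fun k hk => ?_⟩
        · have := h.two_le (j + (n - 1 : ℕ))
          rcases hq (n - 1) (by omega) (by omega) with hf | hf <;> omega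
        · obtain ⟨a, ha, rfl⟩ := exists_eq_add_natCast j k
          have h2a := h.two_le (j + a)
          by_cases ha0 : a = 0
          · simpa [ha0] using h3
          · have han : a ≠ n - 1 := by
              rintro rfl
              exact hk rfl
            have := hc a (by omega) (by omega)
            omega
      have := h.projDimLT_interval_of_three_le hq le_rfl hs1 hs hc
      refine (h.projDimLT_radical_self (d := n - 1 - 1) ?_).of_le (by omega)
      have h1 : frameLength e X j - 1 = 1 + 1 - 1 := by omega
      rwa [h1]
    · refine (h.projDimLT_radical_self (h.projDimLT_interval hq le_rfl h2 hn)).of_le ?_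
      omega
  · exact h.projDimLT_radical_of_ne hq hj

end

/-- While the length is 2, the syzygy of the radical at `b + p` is the radical at `b + p + 1`. The
last one, at `b - 1`, is covered by `e b A` of length 3, so it is not projective. -/
theorem not_projDimLT_radical (h : CyclicFrame K e X) {b : ZMod n} (hb : frameLength e X b = 3)
    (hb2 : ∀ k ≠ b, frameLength e X k = 2) {p : ℕ} (hp : 1 ≤ p) (hpn : p < n) :
    ¬ ProjDimLT Aᵐᵒᵖ (principalRightIdeal (e (b + p) * X ^ 1)) (n - p) := by
  have hne : ∀ q : ℕ, 1 ≤ q → q < n → b + (q : ZMod n) ≠ b := by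
    intro q hq hqn hbq
    rw [add_eq_left, ZMod.natCast_eq_zero_iff] at hbq
    exact absurd (Nat.le_of_dvd (by omega) hbq) (by omega)
  induction hN : n - p using Nat.strong_induction_on generalizing p with
  | _ N ih =>
    subst hN
    intro hd
    have h2 := hb2 _ (hne p hp hpn)
    by_cases hlast : p + 1 = n
    · have h1 : n - p = 1 := by omega
      rw [h1] at hd
      have := h.add_le_of_projDimLT_one (by omega) hd
      rw [h2, add_assoc, ← Nat.cast_add, hlast, ZMod.natCast_self, add_zero, hb] at this
      omega
    · have h1 : n - p = n - (p + 1) + 1 := by omega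
      rw [h1] at hd
      have := h.projDimLT_syzygy (by omega) hd
      rw [h2, add_assoc, ← Nat.cast_add] at this
      exact ih _ (by omega) (by omega) (by omega) rfl this

theorem globalDimension_le (h : CyclicFrame K e X) {d : ℕ}
    (hd : ∀ j, ProjDimLT Aᵐᵒᵖ (principalRightIdeal (e j * X ^ 1)) d) :
    globalDimension A ≤ (d : WithBot ℕ∞) := by
  have := h.moduleFinite
  have : Module.Finite K Aᵐᵒᵖ := Module.Finite.equiv (MulOpposite.opLinearEquiv K)
  have : IsArtinianRing Aᵐᵒᵖ := IsArtinianRing.of_finite K Aᵐᵒᵖ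
  refine iSup₂_le fun M hM => (CategoryTheory.projectiveDimension_le_iff M d).2 ?_
  refine ProjDimLT.of_isFiniteLength (M := M) (fun T _ _ _ => ?_)
    (isFiniteLength_iff_isNoetherian_isArtinian.2 ⟨inferInstance, inferInstance⟩)
  obtain ⟨i, hi⟩ := h.projDimLT_of_isSimpleModule T
  exact hi d (hd i)

/-- The witness is the top `e j A / e j X A`, whose first syzygy is `e j X A`. -/
theorem lt_globalDimension (h : CyclicFrame K e X) {d : ℕ} {j : ZMod n} (hd0 : d ≠ 0)
    (hd : ¬ ProjDimLT Aᵐᵒᵖ (principalRightIdeal (e j * X ^ 1)) d) :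
    ((d + 1 : ℕ) : WithBot ℕ∞) ≤ globalDimension A := by
  let P := principalRightIdeal (e j)
  let N := principalRightIdeal (e j * X ^ 1)
  have hfin : Module.Finite Aᵐᵒᵖ P := by
    have : Module.Finite Aᵐᵒᵖ A := Module.Finite.equiv (opRightModuleEquiv A).symm
    exact Module.Finite.range _
  let M := ModuleCat.of Aᵐᵒᵖ (P ⧸ N.submoduleOf P)
  have hM : ((d + 1 : ℕ) : WithBot ℕ∞) ≤ CategoryTheory.projectiveDimension M := by
    rw [CategoryTheory.projectiveDimension_ge_iff]
    intro hlt
    refine hd (ProjDimLT.of_submodule (h.projective_principalRightIdeal j)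
      (principalRightIdeal_mul_pow_le _ _) (N.submoduleOf P).mkQ_surjective (fun y => ?_) hd0 hlt)
    rw [Submodule.mkQ_apply, Submodule.Quotient.mk_eq_zero]
    rfl
  exact hM.trans (le_iSup₂_of_le M (Module.Finite.quotient _ _) le_rfl)

end CyclicFrame

/-! ### From a bound quiver presentation to a cyclic frame -/

namespace CyclicQuiver

/-- The vertex of the oriented cycle given by an integer modulo `n`. -/
def vertex {n : ℕ} (i : ZMod n) : CyclicQuiver n := i

/-- The successor of a vertex. -/
def next {n : ℕ} (i : CyclicQuiver n) : CyclicQuiver n := (show ZMod n from i) + (1 : ZMod n)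

/-- The arrow `i → i + 1`. -/
def arrow {n : ℕ} (i : CyclicQuiver n) : i ⟶ next i := ⟨rfl⟩

theorem next_injective {n : ℕ} : Function.Injective (next (n := n)) :=
  add_left_injective (1 : ZMod n)

theorem exists_path_length {n : ℕ} (i : CyclicQuiver n) (l : ℕ) :
    ∃ (j : CyclicQuiver n) (p : Quiver.Path i j), p.length = l := by
  induction l with
  | zero => exact ⟨i, Quiver.Path.nil, rfl⟩
  | succ l ih =>
    obtain ⟨j, p, hp⟩ := ih
    exact ⟨_, p.cons (arrow j), by rw [Quiver.Path.length_cons, hp]⟩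

variable (K : Type u) [Field K] (n : ℕ) [NeZero n]

/-- The sum of all arrows in the path algebra of the oriented cycle. -/
noncomputable def arrowSum : PathAlgebra K (CyclicQuiver n) :=
  ∑ i : CyclicQuiver n, PathAlgebra.ofPath K (arrow i).toPath

variable {K n}

theorem ofPath_mul_arrowSum {i j : CyclicQuiver n} (p : Quiver.Path i j) :
    PathAlgebra.ofPath K p * arrowSum K n = PathAlgebra.ofPath K (p.cons (arrow j)) := by
  rw [arrowSum, Finset.mul_sum, Finset.sum_eq_single j]
  · exact PathAlgebra.ofPath_mul_ofPath p (arrow j).toPath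
  · intro k _ hk
    exact PathAlgebra.ofPath_mul_ofPath_of_ne _ _ hk.symm
  · exact fun hj => absurd (Finset.mem_univ j) hj

theorem arrowSum_mul_idem (i : CyclicQuiver n) :
    arrowSum K n * PathAlgebra.idem K (next i) = PathAlgebra.ofPath K (arrow i).toPath := by
  rw [arrowSum, Finset.sum_mul, Finset.sum_eq_single i]
  · exact PathAlgebra.ofPath_mul_ofPath (arrow i).toPath Quiver.Path.nil
  · intro k _ hk
    exact PathAlgebra.ofPath_mul_ofPath_of_ne _ _ fun hki => hk (next_injective hki)
  · exact fun hi => absurd (Finset.mem_univ i) hi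

theorem idem_mul_arrowSum (i : CyclicQuiver n) :
    PathAlgebra.idem K i * arrowSum K n = PathAlgebra.ofPath K (arrow i).toPath :=
  ofPath_mul_arrowSum Quiver.Path.nil

/-- On the oriented cycle a path is determined by its source and its length. -/
theorem ofPath_eq {i j : CyclicQuiver n} (p : Quiver.Path i j) :
    PathAlgebra.ofPath K p = PathAlgebra.idem K i * arrowSum K n ^ p.length := by
  induction p with
  | nil => rw [Quiver.Path.length_nil, pow_zero, mul_one]; rfl
  | @cons b c p a ih =>
    have hc : c = next b := a.down
    subst hc
    rw [Quiver.Path.length_cons, pow_succ, ← mul_assoc, ← ih, ofPath_mul_arrowSum]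
    rfl

end CyclicQuiver

namespace IsBoundQuiverPresentation

open CyclicQuiver

variable {K : Type u} [Field K] {n : ℕ} [NeZero n] {A : Type v} [Ring A] [Algebra K A]
  {φ : PathAlgebra K (CyclicQuiver n) →ₐ[K] A}

theorem ofPath_not_mem_arrowIdealPow {V : Type*} [Quiver V] {i j : V} (p : Quiver.Path i j) {m : ℕ}
    (hm : p.length < m) : PathAlgebra.ofPath K p ∉ PathAlgebra.arrowIdealPow K V m := by
  intro hp
  let f : PathAlgebra K V →ₗ[K] K :=
    (Finsupp.lapply (⟨i, j, p⟩ : Σ i j : V, Quiver.Path i j) :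
      ((Σ i j : V, Quiver.Path i j) →₀ K) →ₗ[K] K)
  have hle : PathAlgebra.arrowIdealPow K V m ≤ LinearMap.ker f := by
    refine Submodule.span_le.2 ?_
    rintro _ ⟨k, l, q, hq, rfl⟩
    refine Finsupp.single_eq_of_ne fun heq => ?_
    have : p.length = q.length :=
      congrArg (fun x : Σ i j : V, Quiver.Path i j => x.2.2.length) heq
    omega
  have h1 : f (PathAlgebra.ofPath K p) = 1 := Finsupp.single_eq_same
  rw [LinearMap.mem_ker.1 (hle hp)] at h1
  exact zero_ne_one h1

theorem cyclicFrame (hφ : IsBoundQuiverPresentation φ) :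
    CyclicFrame K (fun i => φ (PathAlgebra.idem K (vertex i)))
      (φ (arrowSum K n)) where
  mul_self i := by
    rw [← map_mul]
    exact congrArg φ (PathAlgebra.ofPath_mul_ofPath (Quiver.Path.nil : Quiver.Path _ _)
      Quiver.Path.nil)
  mul_of_ne i j hij := by
    rw [← map_mul]
    exact (congrArg φ (PathAlgebra.ofPath_mul_ofPath_of_ne _ _ hij)).trans (map_zero φ)
  sum_eq_one := by
    change ∑ i : CyclicQuiver n, φ (PathAlgebra.idem K i) = 1
    rw [← map_sum]
    exact (congrArg φ PathAlgebra.one_def.symm).trans (map_one φ)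
  mul_X i := by
    rw [← map_mul, ← map_mul, idem_mul_arrowSum]
    exact congrArg φ (arrowSum_mul_idem (vertex i)).symm
  nilpotent := by
    obtain ⟨N, -, hN⟩ := hφ.exists_arrowIdealPow_le
    refine ⟨N, ?_⟩
    rw [← map_pow, ← one_mul (arrowSum K n ^ N), PathAlgebra.one_def, Finset.sum_mul, map_sum]
    refine Finset.sum_eq_zero fun i _ => ?_
    obtain ⟨j, p, rfl⟩ := exists_path_length i N
    rw [← ofPath_eq]
    exact hN (Submodule.subset_span ⟨i, j, p, le_rfl, rfl⟩)
  mem_span a := by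
    obtain ⟨x, rfl⟩ := hφ.surjective a
    set S := Submodule.span K (Set.range fun p : ZMod n × ℕ =>
      φ (PathAlgebra.idem K (vertex p.1)) * φ (arrowSum K n) ^ p.2)
    have : S.mkQ ∘ₗ φ.toLinearMap = 0 := PathAlgebra.hom_ext fun i j p => by
      refine (Submodule.Quotient.mk_eq_zero S).2 (Submodule.subset_span ⟨(i, p.length), ?_⟩)
      change _ = φ (PathAlgebra.ofPath K p)
      rw [ofPath_eq, map_mul, map_pow]
      rfl
    exact (Submodule.Quotient.mk_eq_zero S).1 (LinearMap.congr_fun this x)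
  mul_X_ne_zero i := by
    rw [← map_mul, idem_mul_arrowSum]
    intro h0
    exact ofPath_not_mem_arrowIdealPow (arrow (vertex i)).toPath (by simp) (hφ.le_arrowIdealPow_two h0)

end IsBoundQuiverPresentation

/-! ### Kupisch series up to rotation and the main theorem -/

theorem getElem_replicate_append_three {n i : ℕ} (hi : i < (List.replicate (n - 1) 2 ++ [3]).length) :
    (List.replicate (n - 1) 2 ++ [3])[i] = if i = n - 1 then 3 else 2 := by
  simp only [List.length_append, List.length_replicate, List.length_singleton] at hi
  rw [List.getElem_append]
  split_ifs with h1 h2 h2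
  · simp at h1; omega
  · simp
  · simp
  · simp at h1; omega

theorem ofFn_isRotated_iff {n : ℕ} [NeZero n] (c : ZMod n → ℕ) :
    (List.ofFn fun i : Fin n => c ((i : ℕ) : ZMod n)).IsRotated (List.replicate (n - 1) 2 ++ [3]) ↔
      ∃ b, c b = 3 ∧ ∀ k ≠ b, c k = 2 := by
  have hn := NeZero.pos n
  have key : ∀ k : ℕ, (List.ofFn fun i : Fin n => c ((i : ℕ) : ZMod n)).rotate k =
      List.replicate (n - 1) 2 ++ [3] ↔
        ∀ i < n, c ((i + k : ℕ) : ZMod n) = if i = n - 1 then 3 else 2 := by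
    intro k
    rw [List.ext_getElem_iff]
    simp only [getElem_replicate_append_three, List.getElem_rotate, List.length_rotate,
      List.length_ofFn, List.getElem_ofFn, List.length_append, List.length_replicate,
      List.length_singleton, ZMod.natCast_mod]
    constructor
    · exact fun h i hi => h.2 i hi (by omega)
    · exact fun h => ⟨by omega, fun i hi _ => h i hi⟩
  constructor
  · rintro ⟨k, hk⟩
    rw [key] at hk
    refine ⟨((n - 1 + k : ℕ) : ZMod n), ?_, fun j hj => ?_⟩
    · rw [hk _ (by omega), if_pos rfl]
    · obtain ⟨a, ha, rfl⟩ := CyclicFrame.exists_eq_add_natCast (k : ZMod n) j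
      rw [add_comm, ← Nat.cast_add] at hj ⊢
      rw [hk a ha, if_neg]
      rintro rfl
      exact hj rfl
  · rintro ⟨b, hb, hb2⟩
    -- Starting the list at `b + 1` puts the entry of `b` last.
    refine ⟨(b + 1).val, (key _).2 fun i hi => ?_⟩
    have hb' : (((n - 1 : ℕ) : ZMod n)) + (b + 1) = b := by
      rw [Nat.cast_sub hn, ZMod.natCast_self]
      ring
    rw [Nat.cast_add, ZMod.natCast_zmod_val]
    split_ifs with h
    · rw [h, hb', hb]
    · refine hb2 _ fun heq => h ?_
      have := add_right_cancel (heq.trans hb'.symm)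
      rw [ZMod.natCast_eq_natCast_iff', Nat.mod_eq_of_lt hi, Nat.mod_eq_of_lt (by omega)] at this
      exact this

theorem mainTheorem10 {K : Type u} [Field K] {n : ℕ} [NeZero n] {A : Type v} [Ring A] [Algebra K A]
    (φ : PathAlgebra K (CyclicQuiver n) →ₐ[K] A) (hφ : IsBoundQuiverPresentation φ)
    (hA : IsQuasiHereditary A) :
    (globalDimension A = (n : WithBot ℕ∞) ↔
      (kupischSeries φ).IsRotated (List.replicate (n - 1) 2 ++ [3])) ∧
    (¬ (kupischSeries φ).IsRotated (List.replicate (n - 1) 2 ++ [3]) →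
      globalDimension A ≤ ((n - 1 : ℕ) : WithBot ℕ∞)) := by
  have h := hφ.cyclicFrame
  set e := fun i : ZMod n => φ (PathAlgebra.idem K (CyclicQuiver.vertex i))
  set X := φ (CyclicQuiver.arrowSum K n)
  obtain ⟨i, hi, hk⟩ := h.exists_of_isQuasiHereditary hA
  -- A single vertex is impossible: admissibility makes every length at least 2, while the length at
  -- `i` is at most `n`.
  have hn : 2 ≤ n := (h.two_le i).trans hi
  -- The vertex `i + p` reaches `i` after `n - p` steps, so this is `hk` with `d = n - p`; `1 ≤ p`
  -- ensures `d < n`.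
  have hq : ∀ p : ℕ, 1 ≤ p → p ≤ n → p + frameLength e X (i + (p : ZMod n)) ≤ n ∨
      p + frameLength e X (i + (p : ZMod n)) = n + frameLength e X i := by
    intro p hp hpn
    have hd : i + (p : ZMod n) + ((n - p : ℕ) : ZMod n) = i := by
      rw [add_assoc, ← Nat.cast_add, Nat.add_sub_cancel' hpn, ZMod.natCast_self, add_zero]
    rcases hk _ (n - p) (by omega) hd with h1 | h1 <;> omega
  have hc : kupischSeries φ = List.ofFn fun j : Fin n => frameLength e X ((j : ℕ) : ZMod n) :=
    congrArg List.ofFn (funext fun j => h.finrank_range_mulLeft _)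
  have hK := ofFn_isRotated_iff (frameLength e X)
  rw [← hc] at hK
  have hle : ¬ (kupischSeries φ).IsRotated (List.replicate (n - 1) 2 ++ [3]) →
      globalDimension A ≤ ((n - 1 : ℕ) : WithBot ℕ∞) := fun hnot =>
    h.globalDimension_le (h.projDimLT_radical_of_not hi hq (hK.not.1 hnot))
  refine ⟨⟨fun hg => ?_, fun hrot => ?_⟩, hle⟩
  · by_contra hnot
    have := hle hnot
    rw [hg] at this
    have : n ≤ n - 1 := by exact_mod_cast this
    omega
  · obtain ⟨b, hb, hb2⟩ := hK.1 hrot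
    refine le_antisymm (h.globalDimension_le (h.projDimLT_radical hi hq)) ?_
    have := h.lt_globalDimension (by omega) (h.not_projDimLT_radical hb hb2 le_rfl (by omega))
    rwa [Nat.sub_add_cancel (by omega)] at this
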